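/- All graphs are finite and simple. For a graph $G$ of order $n\ge 1$ (i.e. with $n$ vertices), let $a_k(G)$ denote the number of connected induced subgraphs of $G$ of order $k$ (the number of $k$-element vertex sets that induce a connected subgraph), let $\Phi_G(x)=\sum_{k=1}^{n}a_k(G)x^k$, and let $M_G=\Phi_G'(1)/\Phi_G(1)$ be the mean order of the connected induced subgraphs of $G$. A cograph is a graph with no induced path on $4$ vertices. $K_{1,n-1}$ denotes the star on $n$ vertices. (a) If $G$ is a connected cograph of order $n\ge 7$, then $$M_G\le \frac{n+1}{2}-\frac{(n-1)^2}{2\left(2^{n-1}+n-1\right)},$$ with equality if and only if $G\cong K_{1,n-1}$. Consequently, for each $n\ge 7$ the star $K_{1,n-1}$, which is itself a connected cograph, has the maximum mean among all connected cographs of order $n$: every connected cograph $G$ of order $n$ satisfies $M_G\le M_{K_{1,n-1}}$, with equality if and only if $G\cong K_{1,n-1}$. (b) If $G$ is a connected cograph of order $n\ge 1$, then $M_G\le \frac{n+1}{2}$, with equality if and only if $n=1$. -/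

import Mathlib

namespace SimpleGraph

/-- A graph is a cograph if it contains no induced path on `4` vertices. -/
def IsCograph {V : Type*} (G : SimpleGraph V) : Prop :=
  ¬ (pathGraph 4).IsIndContained G

open Classical in
/-- `a_k(G)`: the number of connected induced subgraphs of `G` of order `k`, that is, the number of
`k`-element vertex sets inducing a connected subgraph (`Connected` includes non-emptiness). -/
noncomputable def numConnectedInduced {V : Type*} [Fintype V] (G : SimpleGraph V) (k : ℕ) : ℕ :=
  (Finset.univ.filter fun S : Finset V => S.card = k ∧ (G.induce (S : Set V)).Connected).card

/-- The connected induced subgraph polynomial `Φ_G(x) = ∑_{k=1}^n a_k(G) x^k`. -/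
noncomputable def connectedInducedPoly {V : Type*} [Fintype V] (G : SimpleGraph V) :
    Polynomial ℝ :=
  ∑ k ∈ Finset.Icc 1 (Fintype.card V),
    Polynomial.C (G.numConnectedInduced k : ℝ) * Polynomial.X ^ k

/-- The global mean `M_G = Φ_G'(1) / Φ_G(1)`: the mean order of the connected induced subgraphs
of `G`. -/
noncomputable def globalMean {V : Type*} [Fintype V] (G : SimpleGraph V) : ℝ :=
  (Polynomial.derivative G.connectedInducedPoly).eval 1 / G.connectedInducedPoly.eval 1

end SimpleGraph

/-! For connected cographs the mean is (n+1)/2 - D/(2T). Here T counts the nonempty connected vertex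
sets S, and D (`connDeficit`) sums n+1-2|S| over them. A star has D = (n-1)^2 and T = k :=
2^(n-1)+n-1, so both parts concern lower bounds for D: D > 0 for n ≥ 2, and (n-1)^2 T ≤ kD, strict
unless G is a star. A connected cograph is a join of parts B and C (`InducedPathFree.exists_split`).
Every set meeting both parts is connected, so its contribution is explicit. Sets inside one part are
controlled by `connExcess`, whose nonnegativity follows by induction over the cograph decomposition.
Singletons are counted separately, so an edgeless part contributes nothing to the counts. If B is a
single vertex and m = |C|, the claim reduces to m^2 N(C) < (2^m+m) E(C), where N and E are the count
and excess of C (`InducedPathFree.sq_mul_connCount_lt`); N(C) = 0 is the star. If both parts have at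
least two vertices, the crossing sets and singletons already give a strict inequality
(`join_contribution_lt`). -/

open Finset

/-! ### Decomposition of cographs into disjoint unions and joins. -/

namespace SimpleGraph

variable {V : Type*}

/-- `a, b, c, d` never span an induced path in this order. -/
def InducedPathFree (G : SimpleGraph V) : Prop :=
  ∀ ⦃a b c d : V⦄, G.Adj a b → G.Adj b c → G.Adj c d → a ≠ c → b ≠ d → a ≠ d →
    ¬ G.Adj a c → ¬ G.Adj b d → ¬ G.Adj a d → False

theorem IsCograph.inducedPathFree {G : SimpleGraph V} (h : G.IsCograph) :
    G.InducedPathFree := by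
  intro a b c d hab hbc hcd hac hbd had nac nbd nad
  refine h ⟨⟨⟨![a, b, c, d], ?_⟩, ?_⟩⟩
  · intro i j hij
    have := hab.ne; have := hbc.ne; have := hcd.ne
    fin_cases i <;> fin_cases j <;> simp_all
  · intro i j
    have hba := hab.symm; have hcb := hbc.symm; have hdc := hcd.symm
    have nca : ¬ G.Adj c a := fun h => nac h.symm
    have ndb : ¬ G.Adj d b := fun h => nbd h.symm
    have nda : ¬ G.Adj d a := fun h => nad h.symm
    change G.Adj (![a, b, c, d] i) (![a, b, c, d] j) ↔ _
    fin_cases i <;> fin_cases j <;> simp_all [pathGraph_adj]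

/-- The path on four vertices is self-complementary: a, b, c, d becomes c, a, d, b. -/
theorem InducedPathFree.compl {G : SimpleGraph V} (h : G.InducedPathFree) :
    Gᶜ.InducedPathFree := by
  intro a b c d hab hbc hcd hac hbd had nac nbd nad
  simp only [compl_adj, ne_eq, not_and, not_not] at *
  exact h (nac hac).symm (nad had) (nbd hbd).symm (fun e => hcd.1 e) hab.1 (fun e => hbc.1 e.symm)
    hcd.2 hab.2 (fun e => hbc.2 e.symm)

/-- If `A` splits into two non-adjacent parts, then so does `insert v A`, unless `v` is adjacent
to all of `A`. -/
theorem InducedPathFree.exists_split_insert [DecidableEq V] {G : SimpleGraph V}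
    (h : G.InducedPathFree) {A B C : Finset V} {v : V} (hv : v ∉ A) (hB : B.Nonempty)
    (hC : C.Nonempty) (hBC : Disjoint B C) (hA : B ∪ C = A)
    (hadj : ∀ b ∈ B, ∀ c ∈ C, ¬ G.Adj b c) :
    (∀ a ∈ A, G.Adj v a) ∨ ∃ B C : Finset V, B.Nonempty ∧ C.Nonempty ∧ Disjoint B C ∧
      B ∪ C = insert v A ∧ ∀ b ∈ B, ∀ c ∈ C, ¬ G.Adj b c := by
  classical
  refine or_iff_not_imp_left.mpr fun hall => ?_
  push Not at hall
  obtain ⟨u, huA, hvu⟩ := hall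
  -- A smallest member K of `F` plays the role of the component of u in A; it is proper because A
  -- splits.
  let F := A.powerset.filter fun K => u ∈ K ∧ K ≠ A ∧ ∀ x ∈ K, ∀ y ∈ A \ K, ¬ G.Adj x y
  have hF : F.Nonempty := by
    have hdisj := Finset.disjoint_left.mp hBC
    rcases Finset.mem_union.mp (hA ▸ huA) with hu | hu
    · refine ⟨B, ?_⟩
      obtain ⟨c, hc⟩ := hC
      simp only [F, Finset.mem_filter, Finset.mem_powerset]
      refine ⟨hA ▸ Finset.subset_union_left, hu, ?_, ?_⟩
      · rintro rfl
        exact hdisj (hA ▸ Finset.mem_union_right _ hc) hc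
      · intro x hx y hy
        rw [← hA] at hy
        simp only [Finset.mem_sdiff, Finset.mem_union] at hy
        exact hadj x hx y (by tauto)
    · refine ⟨C, ?_⟩
      obtain ⟨c, hc⟩ := hB
      simp only [F, Finset.mem_filter, Finset.mem_powerset]
      refine ⟨hA ▸ Finset.subset_union_right, hu, ?_, ?_⟩
      · rintro rfl
        exact hdisj hc (hA ▸ Finset.mem_union_left _ hc)
      · intro x hx y hy hxy
        rw [← hA] at hy
        simp only [Finset.mem_sdiff, Finset.mem_union] at hy
        exact hadj y (by tauto) x hx hxy.symm
  obtain ⟨K, hKF, hmin⟩ := F.exists_min_image Finset.card hF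
  simp only [F, Finset.mem_filter, Finset.mem_powerset] at hKF hmin
  obtain ⟨hKA, huK, hKne, hK⟩ := hKF
  have hrest : (A \ K).Nonempty := by
    rw [Finset.sdiff_nonempty]
    exact fun hAK => hKne (hKA.antisymm hAK)
  by_cases hx : ∃ x ∈ K, G.Adj v x
  · obtain ⟨x, hxK, hvx⟩ := hx
    by_cases hw : ∃ w ∈ A \ K, G.Adj v w
    -- By minimality, the non-neighbours of v in K send an edge yz to a neighbour z of v in K. With
    -- a neighbour w of v outside K, this makes w, v, z, y an induced path.
    · exfalso
      obtain ⟨w, hw, hvw⟩ := hw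
      have hlt : (K.filter fun z => ¬ G.Adj v z).card < K.card :=
        Finset.card_lt_card (Finset.filter_ssubset.mpr ⟨x, hxK, by simpa using hvx⟩)
      have hnot : ∃ y ∈ K.filter fun z => ¬ G.Adj v z,
          ∃ z ∈ A \ (K.filter fun z => ¬ G.Adj v z), G.Adj y z := by
        by_contra! hcon
        refine absurd (hmin (K.filter fun z => ¬ G.Adj v z)
          ⟨(Finset.filter_subset _ _).trans hKA, by simp [huK, hvu], ?_, hcon⟩) (by omega)
        intro e
        have := Finset.filter_subset (fun z => ¬ G.Adj v z) K
        rw [e] at this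
        exact hKne (hKA.antisymm this)
      obtain ⟨y, hy, z, hz, hyz⟩ := hnot
      simp only [Finset.mem_filter, Finset.mem_sdiff, not_and, not_not] at hy hz hw
      have hzK : z ∈ K := by
        by_contra hzK
        exact hK y hy.1 z (by simp [hz.1, hzK]) hyz
      have hvz := hz.2 hzK
      have hwA : w ∈ A \ K := by simpa using hw
      have hwz := hK z hzK w hwA
      have hwy := hK y hy.1 w hwA
      refine h hvw.symm hvz hyz.symm ?_ ?_ ?_ (fun e => hwz e.symm) hy.2 (fun e => hwy e.symm)
      · rintro rfl; exact hw.2 hzK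
      · rintro rfl; exact hv (hKA hy.1)
      · rintro rfl; exact hw.2 hy.1
    · push Not at hw
      refine ⟨insert v K, A \ K, Finset.insert_nonempty _ _, hrest, ?_, ?_, ?_⟩
      · rw [Finset.disjoint_insert_left]
        exact ⟨by simp [hv], Finset.disjoint_sdiff⟩
      · rw [Finset.insert_union, Finset.union_sdiff_of_subset hKA]
      · intro b hb c hc
        rcases Finset.mem_insert.mp hb with rfl | hb
        · exact hw c hc
        · exact hK b hb c hc
  · push Not at hx
    refine ⟨K, insert v (A \ K), ⟨u, huK⟩, Finset.insert_nonempty _ _, ?_, ?_, ?_⟩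
    · rw [Finset.disjoint_insert_right]
      exact ⟨fun hvK => hv (hKA hvK), Finset.disjoint_sdiff⟩
    · rw [Finset.union_insert, Finset.union_sdiff_of_subset hKA]
    · intro b hb c hc
      rcases Finset.mem_insert.mp hc with rfl | hc
      · exact fun e => hx b hb e.symm
      · exact hK b hb c hc

/-- Every set of at least two vertices of a cograph splits into two parts that are completely
non-adjacent or completely adjacent. -/
theorem InducedPathFree.exists_split [DecidableEq V] {G : SimpleGraph V}
    (h : G.InducedPathFree) (A : Finset V) (hA : 2 ≤ A.card) :
    ∃ B C : Finset V, B.Nonempty ∧ C.Nonempty ∧ Disjoint B C ∧ B ∪ C = A ∧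
      ((∀ b ∈ B, ∀ c ∈ C, ¬ G.Adj b c) ∨ ∀ b ∈ B, ∀ c ∈ C, G.Adj b c) := by
  induction A using Finset.induction_on with
  | empty => simp at hA
  | insert v A hv ih =>
    rw [Finset.card_insert_of_notMem hv] at hA
    have hAne : A.Nonempty := Finset.card_pos.mp (by omega)
    have hsingle : ({v} : Finset V) ∪ A = insert v A := by rw [Finset.insert_eq]
    have hvA : Disjoint ({v} : Finset V) A := by simpa using hv
    rcases Nat.lt_or_ge A.card 2 with hlt | hge
    · obtain ⟨a, rfl⟩ := Finset.card_eq_one.mp (show A.card = 1 by omega)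
      refine ⟨{v}, {a}, by simp, by simp, hvA, hsingle, ?_⟩
      simpa using (em (G.Adj v a)).symm
    · obtain ⟨B, C, hB, hC, hBC, hU, hadj | hadj⟩ := ih hge
      · rcases h.exists_split_insert hv hB hC hBC hU hadj with hall | ⟨B', C', h1, h2, h3, h4, h5⟩
        · exact ⟨{v}, A, by simp, hAne, hvA, hsingle, Or.inr (by simpa using hall)⟩
        · exact ⟨B', C', h1, h2, h3, h4, Or.inl h5⟩
      · have hne : ∀ {B C : Finset V}, Disjoint B C → ∀ b ∈ B, ∀ c ∈ C, b ≠ c :=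
          fun hd b hb c hc e => Finset.disjoint_left.mp hd hb (e ▸ hc)
        -- A completely adjacent split is a non-adjacent one in the complement.
        rcases h.compl.exists_split_insert hv hB hC hBC hU
          (fun b hb c hc e => ((compl_adj _ _ _).mp e).2 (hadj b hb c hc))
          with hall | ⟨B', C', h1, h2, h3, h4, h5⟩
        · exact ⟨{v}, A, by simp, hAne, hvA, hsingle, Or.inl (by
            simpa using fun c hc => ((compl_adj _ _ _).mp (hall c hc)).2)⟩
        · refine ⟨B', C', h1, h2, h3, h4, Or.inr fun b hb c hc => ?_⟩
          by_contra hbc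
          exact h5 b hb c hc ((compl_adj _ _ _).mpr ⟨hne h3 b hb c hc, hbc⟩)

/-- A vertex set that meets both of two completely adjacent parts induces a connected subgraph. -/
theorem connected_induce_union_of_forall_adj {G : SimpleGraph V} [DecidableEq V] {B C : Finset V}
    (hB : B.Nonempty) (hC : C.Nonempty) (hadj : ∀ b ∈ B, ∀ c ∈ C, G.Adj b c) :
    (G.induce ((B ∪ C : Finset V) : Set V)).Connected := by
  obtain ⟨b₀, hb₀⟩ := hB
  obtain ⟨c₀, hc₀⟩ := hC
  have key : ∀ x : ((B ∪ C : Finset V) : Set V),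
      (G.induce ((B ∪ C : Finset V) : Set V)).Reachable ⟨b₀, by simp [hb₀]⟩ x := by
    have hb : (G.induce ((B ∪ C : Finset V) : Set V)).Reachable ⟨b₀, by simp [hb₀]⟩
        ⟨c₀, by simp [hc₀]⟩ := Adj.reachable (hadj b₀ hb₀ c₀ hc₀)
    rintro ⟨x, hx⟩
    rcases Finset.mem_union.mp (Finset.mem_coe.mp hx) with h | h
    · exact hb.trans (Adj.reachable (hadj x h c₀ hc₀).symm)
    · exact Adj.reachable (hadj b₀ hb₀ x h)
  have : Nonempty ((B ∪ C : Finset V) : Set V) := ⟨⟨b₀, by simp [hb₀]⟩⟩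
  exact Connected.mk fun x y => (key x).symm.trans (key y)

/-- A connected vertex set inside two non-adjacent parts lies in one of them. -/
theorem subset_or_subset_of_connected {G : SimpleGraph V} [DecidableEq V] {B C S : Finset V}
    (hS : S ⊆ B ∪ C) (hadj : ∀ b ∈ B, ∀ c ∈ C, ¬ G.Adj b c)
    (hconn : (G.induce (S : Set V)).Connected) : S ⊆ B ∨ S ⊆ C := by
  have closed : ∀ {P : V → Prop}, (∀ x ∈ S, ∀ y ∈ S, P x → G.Adj x y → P y) →
      ∀ x y : (S : Set V), P x → P y := by
    intro P hP x y hx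
    obtain ⟨p⟩ := hconn.preconnected x y
    induction p with
    | nil => exact hx
    | cons hab _ ih => exact ih (hP _ (Finset.mem_coe.mp (Subtype.property _)) _
        (Finset.mem_coe.mp (Subtype.property _)) hx hab)
  obtain ⟨⟨x, hx⟩⟩ := hconn.nonempty
  rcases Finset.mem_union.mp (hS hx) with h | h
  · refine Or.inl fun y hy => closed (P := (· ∈ B)) ?_ ⟨x, hx⟩ ⟨y, hy⟩ h
    intro a ha b hb haB hab
    exact (Finset.mem_union.mp (hS hb)).resolve_right fun hbC => hadj a haB b hbC hab
  · refine Or.inr fun y hy => closed (P := (· ∈ C)) ?_ ⟨x, hx⟩ ⟨y, hy⟩ h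
    intro a ha b hb haC hab
    exact (Finset.mem_union.mp (hS hb)).resolve_left fun hbB => hadj b hbB a haC hab.symm

end SimpleGraph

theorem Finset.sum_powerset_union_of_disjoint {α M : Type*} [DecidableEq α] [AddCommMonoid M]
    {B C : Finset α} (h : Disjoint B C) (g : Finset α → M) :
    ∑ S ∈ (B ∪ C).powerset, g S = ∑ s ∈ B.powerset, ∑ t ∈ C.powerset, g (s ∪ t) := by
  rw [← Finset.sum_product']
  symm
  refine Finset.sum_nbij' (fun p => p.1 ∪ p.2) (fun S => (S ∩ B, S ∩ C)) ?_ ?_ ?_ ?_ ?_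
  · intro p hp
    simp only [mem_product, mem_powerset] at hp ⊢
    exact union_subset_union hp.1 hp.2
  · intro S _
    simp [inter_subset_right]
  · rintro ⟨s, t⟩ hp
    simp only [mem_product, mem_powerset] at hp
    have h1 : t ∩ B = ∅ := disjoint_iff_inter_eq_empty.mp (h.symm.mono_left hp.2)
    have h2 : s ∩ C = ∅ := disjoint_iff_inter_eq_empty.mp (h.mono_left hp.1)
    simp [union_inter_distrib_right, h1, h2, inter_eq_left.mpr hp.1, inter_eq_left.mpr hp.2]
  · intro S hS
    simp only [mem_powerset] at hS
    rw [← inter_union_distrib_left, inter_eq_left.mpr hS]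
  · intros; rfl

theorem Finset.two_mul_sum_powerset_card {α : Type*} [DecidableEq α] (B : Finset α) :
    2 * ∑ s ∈ B.powerset, (s.card : ℝ) = B.card * 2 ^ B.card := by
  induction B using Finset.induction_on with
  | empty => simp
  | insert a B ha ih =>
    have : ∑ t ∈ B.powerset, ((insert a t).card : ℝ) = ∑ t ∈ B.powerset, ((t.card : ℝ) + 1) := by
      refine sum_congr rfl fun t ht => ?_
      rw [card_insert_of_notMem fun hat => ha (mem_powerset.mp ht hat)]
      push_cast; rfl
    rw [sum_powerset_insert ha, this, sum_add_distrib, card_insert_of_notMem ha]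
    simp only [sum_const, card_powerset, nsmul_eq_mul, mul_one]
    push_cast
    rw [pow_succ]
    linarith

/-! ### Counts and total sizes of connected sets in unions and joins. -/

namespace SimpleGraph

variable {V : Type*}

open Classical in
/-- The subsets of `A` with at least two elements that induce a connected subgraph. -/
noncomputable def connSets (G : SimpleGraph V) (A : Finset V) : Finset (Finset V) :=
  A.powerset.filter fun S => 2 ≤ S.card ∧ (G.induce (S : Set V)).Connected

/-- The number of connected subsets of `A` with at least two elements. -/
noncomputable def connCount (G : SimpleGraph V) (A : Finset V) : ℝ := (G.connSets A).card

/-- The total size of the connected subsets of `A` with at least two elements. -/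
noncomputable def connWeight (G : SimpleGraph V) (A : Finset V) : ℝ :=
  ∑ S ∈ G.connSets A, (S.card : ℝ)

theorem mem_connSets {G : SimpleGraph V} {A S : Finset V} :
    S ∈ G.connSets A ↔ S ⊆ A ∧ 2 ≤ S.card ∧ (G.induce (S : Set V)).Connected := by
  simp [connSets]

theorem connCount_nonneg (G : SimpleGraph V) (A : Finset V) : 0 ≤ G.connCount A :=
  Nat.cast_nonneg _

theorem connCount_eq_zero_or_one_le (G : SimpleGraph V) (A : Finset V) :
    G.connCount A = 0 ∨ 1 ≤ G.connCount A := by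
  unfold connCount
  rcases Nat.eq_zero_or_pos (G.connSets A).card with h | h
  · left; simp [h]
  · right; exact_mod_cast h

theorem connSets_eq_empty {G : SimpleGraph V} {A : Finset V} (hA : A.card < 2) :
    G.connSets A = ∅ := by
  refine Finset.eq_empty_of_forall_notMem fun S hS => ?_
  obtain ⟨h1, h2, -⟩ := mem_connSets.mp hS
  have := Finset.card_le_card h1
  omega

theorem connCount_eq_zero_of_card {G : SimpleGraph V} {A : Finset V} (hA : A.card < 2) :
    G.connCount A = 0 := by
  simp [connCount, connSets_eq_empty hA]

variable {G : SimpleGraph V} {B C : Finset V}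

theorem disjoint_connSets (h : Disjoint B C) : Disjoint (G.connSets B) (G.connSets C) := by
  rw [Finset.disjoint_left]
  intro S hB hC
  have h1 := (mem_connSets.mp hB).1
  have h2 := mem_connSets.mp hC
  obtain ⟨x, hx⟩ := Finset.card_pos.mp (show 0 < S.card by omega)
  exact Finset.disjoint_left.mp h (h1 hx) (h2.1 hx)

variable [DecidableEq V]

theorem connSets_union (h : ∀ b ∈ B, ∀ c ∈ C, ¬ G.Adj b c) :
    G.connSets (B ∪ C) = G.connSets B ∪ G.connSets C := by
  ext S
  simp only [mem_connSets, Finset.mem_union]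
  constructor
  · rintro ⟨h1, h2, h3⟩
    rcases subset_or_subset_of_connected h1 h h3 with h4 | h4
    · exact Or.inl ⟨h4, h2, h3⟩
    · exact Or.inr ⟨h4, h2, h3⟩
  · rintro (⟨h1, h2⟩ | ⟨h1, h2⟩)
    · exact ⟨h1.trans subset_union_left, h2⟩
    · exact ⟨h1.trans subset_union_right, h2⟩

theorem connCount_union (hd : Disjoint B C) (h : ∀ b ∈ B, ∀ c ∈ C, ¬ G.Adj b c) :
    G.connCount (B ∪ C) = G.connCount B + G.connCount C := by
  simp [connCount, connSets_union h, card_union_of_disjoint (disjoint_connSets hd)]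

theorem connWeight_union (hd : Disjoint B C) (h : ∀ b ∈ B, ∀ c ∈ C, ¬ G.Adj b c) :
    G.connWeight (B ∪ C) = G.connWeight B + G.connWeight C := by
  simp [connWeight, connSets_union h, sum_union (disjoint_connSets hd)]

/-- A set meeting both parts is automatically connected and has at least two elements, so
connectivity only has to be tested on sets inside one part. -/
theorem sum_connSets_join (hd : Disjoint B C) (h : ∀ b ∈ B, ∀ c ∈ C, G.Adj b c)
    (f : Finset V → ℝ) :
    ∑ S ∈ G.connSets (B ∪ C), f S = ∑ S ∈ G.connSets B, f S + ∑ S ∈ G.connSets C, f S +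
      ∑ s ∈ B.powerset.erase ∅, ∑ t ∈ C.powerset.erase ∅, f (s ∪ t) := by
  classical
  set g : Finset V → ℝ := fun S =>
    if 2 ≤ S.card ∧ (G.induce (S : Set V)).Connected then f S else 0 with hg
  have hg0 : g ∅ = 0 := by simp [hg]
  have hsum : ∀ A, ∑ S ∈ G.connSets A, f S = ∑ S ∈ A.powerset, g S := fun A => by
    simp only [connSets, sum_filter, hg]
    congr!
  rw [hsum, hsum, hsum, sum_powerset_union_of_disjoint hd,
    ← Finset.add_sum_erase B.powerset _ (empty_mem_powerset B),
    ← Finset.add_sum_erase B.powerset g (empty_mem_powerset B), hg0]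
  have hinner : ∀ s ∈ B.powerset.erase ∅, ∑ t ∈ C.powerset, g (s ∪ t) =
      g s + ∑ t ∈ C.powerset.erase ∅, f (s ∪ t) := by
    intro s hs
    rw [← Finset.add_sum_erase C.powerset _ (empty_mem_powerset C), union_empty]
    congr 1
    refine sum_congr rfl fun t ht => ?_
    simp only [mem_erase, mem_powerset, ← nonempty_iff_ne_empty] at hs ht
    refine if_pos ⟨?_, connected_induce_union_of_forall_adj hs.1 ht.1
      fun b hb c hc => h b (hs.2 hb) c (ht.2 hc)⟩
    rw [card_union_of_disjoint (hd.mono hs.2 ht.2)]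
    have := hs.1.card_pos
    have := ht.1.card_pos
    omega
  rw [sum_congr rfl hinner, sum_add_distrib]
  simp only [empty_union]
  ring

theorem card_powerset_erase_empty (B : Finset V) :
    ((B.powerset.erase ∅).card : ℝ) = 2 ^ B.card - 1 := by
  rw [cast_card_erase_of_mem (empty_mem_powerset B), card_powerset]
  push_cast; rfl

theorem sum_card_powerset_erase_empty (B : Finset V) :
    2 * ∑ s ∈ B.powerset.erase ∅, (s.card : ℝ) = B.card * 2 ^ B.card := by
  rw [← two_mul_sum_powerset_card, sum_erase _ (by simp)]

theorem connCount_join (hd : Disjoint B C) (h : ∀ b ∈ B, ∀ c ∈ C, G.Adj b c) :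
    G.connCount (B ∪ C) =
      G.connCount B + G.connCount C + (2 ^ B.card - 1) * (2 ^ C.card - 1) := by
  have := sum_connSets_join hd h fun _ => 1
  simp only [sum_const, nsmul_eq_mul, mul_one, card_powerset_erase_empty] at this
  exact this

theorem two_mul_connWeight_join (hd : Disjoint B C) (h : ∀ b ∈ B, ∀ c ∈ C, G.Adj b c) :
    2 * G.connWeight (B ∪ C) = 2 * G.connWeight B + 2 * G.connWeight C +
      B.card * 2 ^ B.card * (2 ^ C.card - 1) + C.card * 2 ^ C.card * (2 ^ B.card - 1) := by
  have hinner : ∑ s ∈ B.powerset.erase ∅, ∑ t ∈ C.powerset.erase ∅, ((s ∪ t).card : ℝ) =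
      ∑ s ∈ B.powerset.erase ∅, ∑ t ∈ C.powerset.erase ∅, ((s.card : ℝ) + t.card) := by
    refine sum_congr rfl fun s hs => sum_congr rfl fun t ht => ?_
    simp only [mem_erase, mem_powerset] at hs ht
    rw [card_union_of_disjoint (hd.mono hs.2 ht.2)]
    push_cast; rfl
  unfold connWeight
  rw [sum_connSets_join hd h, hinner]
  simp only [sum_add_distrib, sum_const, nsmul_eq_mul, card_powerset_erase_empty, ← mul_sum]
  rw [← sum_card_powerset_erase_empty, ← sum_card_powerset_erase_empty]
  ring

end SimpleGraph

/-! ### Exponential against quadratic inequalities. -/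

section Numeric

theorem natCast_le_two_pow_sub_one (p : ℕ) : (p : ℝ) ≤ 2 ^ p - 1 := by
  have : p + 1 ≤ 2 ^ p := Nat.lt_two_pow_self
  have : ((p + 1 : ℕ) : ℝ) ≤ ((2 ^ p : ℕ) : ℝ) := by exact_mod_cast this
  push_cast at this
  linarith

theorem two_le_two_pow {p : ℕ} (hp : 1 ≤ p) : (2 : ℝ) ≤ 2 ^ p := by
  simpa using pow_le_pow_right₀ (one_le_two (α := ℝ)) hp

theorem five_mul_sq_add_eight_lt {m : ℕ} (hm : 6 ≤ m) : 5 * (m : ℝ) ^ 2 + 8 < 4 * 2 ^ m := by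
  induction m, hm using Nat.le_induction with
  | base => norm_num
  | succ m hm ih =>
    have : (6 : ℝ) ≤ m := by exact_mod_cast hm
    push_cast
    rw [pow_succ 2 m]
    nlinarith

theorem five_mul_sq_le {m : ℕ} (hm : 6 ≤ m) : 5 * (m : ℝ) ^ 2 ≤ 3 * (2 ^ m + m) := by
  induction m, hm using Nat.le_induction with
  | base => norm_num
  | succ m hm ih =>
    have : (6 : ℝ) ≤ m := by exact_mod_cast hm
    push_cast
    rw [pow_succ 2 m]
    nlinarith

theorem sq_add_six_mul_add_one_lt {q : ℕ} (hq : 5 ≤ q) : (q : ℝ) ^ 2 + 6 * q + 1 < 2 * 2 ^ q := by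
  induction q, hq using Nat.le_induction with
  | base => norm_num
  | succ m hm ih =>
    have : (5 : ℝ) ≤ m := by exact_mod_cast hm
    push_cast
    rw [pow_succ 2 m]
    nlinarith

theorem sq_add_ten_mul_add_six_le {q : ℕ} (hq : 4 ≤ q) :
    (q : ℝ) ^ 2 + 10 * q + 6 ≤ 4 * 2 ^ q := by
  induction q, hq using Nat.le_induction with
  | base => norm_num
  | succ m hm ih =>
    have : (4 : ℝ) ≤ m := by exact_mod_cast hm
    push_cast
    rw [pow_succ 2 m]
    nlinarith

theorem eleven_mul_sq_le {q : ℕ} (hq : 4 ≤ q) :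
    11 * (q : ℝ) ^ 2 ≤ 16 * (2 ^ q - 1 - q) := by
  induction q, hq using Nat.le_induction with
  | base => norm_num
  | succ m hm ih =>
    have : (4 : ℝ) ≤ m := by exact_mod_cast hm
    push_cast
    rw [pow_succ 2 m]
    nlinarith

/-- With P = 2^p and Q = 2^q, (P-2)(Q-2) ≥ 0 gives 2(P-1)(Q-1) ≥ PQ-2, and 4pq ≤ (p+q)^2. The 8 in
`five_mul_sq_add_eight_lt` pays for the -2. -/
theorem five_mul_mul_lt {p q : ℕ} (hp : 1 ≤ p) (hq : 1 ≤ q) (h : 6 ≤ p + q) :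
    5 * ((p : ℝ) * q) < 2 * ((2 ^ p - 1) * (2 ^ q - 1)) := by
  have h1 := five_mul_sq_add_eight_lt h
  have h2 := two_le_two_pow hp
  have h3 := two_le_two_pow hq
  rw [pow_add] at h1
  push_cast at h1
  nlinarith [mul_nonneg (sub_nonneg.mpr h2) (sub_nonneg.mpr h3), sq_nonneg ((p : ℝ) - q)]

theorem two_mul_sq_le_of_three_le {p q : ℕ} (hp : 3 ≤ p) (hpq : p ≤ q) (h : 7 ≤ p + q) :
    2 * ((p : ℝ) + q - 1) ^ 2 ≤
      (2 ^ p - 1 - p) * (2 ^ q - 1 - q) - p * q + (p + q) * (p + q - 1) := by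
  rcases hp.eq_or_lt with rfl | hp
  · have := sq_add_ten_mul_add_six_le (q := q) (by omega)
    norm_num
    nlinarith
  -- The ratio 11/16 is attained at 4, the smallest size left.
  · have h1 := eleven_mul_sq_le (q := p) (by omega)
    have h2 := eleven_mul_sq_le (q := q) (by omega)
    have hp' : (4 : ℝ) ≤ p := by exact_mod_cast hp
    have hq' : (4 : ℝ) ≤ q := by exact_mod_cast (show 4 ≤ q by omega)
    have h3 : 11 * (p : ℝ) ^ 2 * (11 * (q : ℝ) ^ 2) ≤
        16 * (2 ^ p - 1 - p) * (16 * (2 ^ q - 1 - q)) :=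
      mul_le_mul h1 h2 (by positivity) ((by positivity : 0 ≤ 11 * (p : ℝ) ^ 2).trans h1)
    have h4 : (16 : ℝ) ≤ p ^ 2 := by nlinarith
    have h5 : (16 : ℝ) ≤ q ^ 2 := by nlinarith
    have h6 : 16 ≤ (p : ℝ) * q := by nlinarith
    have h7 : 16 * (q : ℝ) ^ 2 ≤ (p : ℝ) ^ 2 * q ^ 2 :=
      mul_le_mul_of_nonneg_right h4 (by positivity)
    have h8 : (p : ℝ) ^ 2 * 16 ≤ (p : ℝ) ^ 2 * q ^ 2 :=
      mul_le_mul_of_nonneg_left h5 (by positivity)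
    have h9 : 16 * ((p : ℝ) * q) ≤ (p : ℝ) ^ 2 * q ^ 2 := by
      have := mul_le_mul_of_nonneg_right h6 (by positivity : 0 ≤ (p : ℝ) * q)
      linarith [this, (by ring : (p : ℝ) * q * (p * q) = p ^ 2 * q ^ 2)]
    have h10 : 0 ≤ (p : ℝ) ^ 2 * q ^ 2 := by positivity
    nlinarith

/-- The contribution of the sets meeting both parts of a join with parts of sizes `p` and `q`. -/
theorem join_contribution_lt {p q : ℕ} (hp : 2 ≤ p) (hpq : p ≤ q) (h : 7 ≤ p + q) :
    ((p : ℝ) + q - 1) ^ 2 * ((2 ^ p - 1) * (2 ^ q - 1) + (p + q)) <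
      (2 ^ p * 2 ^ q / 2 + (p + q) - 1) *
        ((2 ^ p - 1 - p) * (2 ^ q - 1 - q) - p * q + (p + q) * (p + q - 1)) := by
  have hq7 : (7 : ℝ) ≤ p + q := by exact_mod_cast h
  have hP := two_le_two_pow (p := p) (by omega)
  have hQ := two_le_two_pow (p := q) (by omega)
  have hPQ : 0 < (2 : ℝ) ^ p * 2 ^ q := by positivity
  have hr : 0 < ((p : ℝ) + q - 1) ^ 2 := pow_pos (by linarith) 2
  -- The number of crossing sets and singletons is at most 3/2 of the star's total if p = 2, and
  -- less than twice it if p ≥ 3. Their deficit exceeds 3/2 of (n-1)^2, respectively is at least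
  -- 2(n-1)^2.
  rcases hp.eq_or_lt with rfl | hp
  · have h1 := sq_add_six_mul_add_one_lt (q := q) (by omega)
    have h2 : 3 * (((2 : ℕ) : ℝ) + q - 1) ^ 2 < 2 * ((2 ^ 2 - 1 - (2 : ℕ)) * (2 ^ q - 1 - q) -
        (2 : ℕ) * q + ((2 : ℕ) + q) * ((2 : ℕ) + q - 1)) := by
      push_cast; nlinarith
    have h3 : 2 * (((2 : ℝ) ^ 2 - 1) * (2 ^ q - 1) + ((2 : ℕ) + q)) ≤
        3 * (2 ^ 2 * 2 ^ q / 2 + ((2 : ℕ) + q) - 1) := by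
      push_cast; nlinarith
    nlinarith [mul_le_mul_of_nonneg_left h3 hr.le,
      mul_lt_mul_of_pos_left h2 (show 0 < (2 : ℝ) ^ 2 * 2 ^ q / 2 + ((2 : ℕ) + q) - 1 by linarith)]
  · have h2 := two_mul_sq_le_of_three_le hp hpq h
    have h3 : ((2 : ℝ) ^ p - 1) * (2 ^ q - 1) + (p + q) <
        2 * (2 ^ p * 2 ^ q / 2 + (p + q) - 1) := by nlinarith
    nlinarith [mul_lt_mul_of_pos_left h3 hr,
      mul_le_mul_of_nonneg_left h2
        (show 0 ≤ (2 : ℝ) ^ p * 2 ^ q / 2 + (p + q) - 1 by linarith)]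

end Numeric

/-! ### Lower bounds for excess and deficit. -/

namespace SimpleGraph

variable {V : Type*} [DecidableEq V] {G : SimpleGraph V}

/-- The sum of `|A| + 2 - 2 |S|` over the connected subsets `S` of `A` with at least two
elements. -/
noncomputable def connExcess (G : SimpleGraph V) (A : Finset V) : ℝ :=
  (A.card + 2) * G.connCount A - 2 * G.connWeight A

theorem connExcess_union {B C : Finset V} (hd : Disjoint B C)
    (h : ∀ b ∈ B, ∀ c ∈ C, ¬ G.Adj b c) :
    G.connExcess (B ∪ C) = G.connExcess B + G.connExcess C +
      C.card * G.connCount B + B.card * G.connCount C := by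
  unfold connExcess
  rw [connCount_union hd h, connWeight_union hd h, card_union_of_disjoint hd]
  push_cast
  ring

/-- Over all subsets s of B, |B|-2|s| sums to zero by complementation, hence to -|B| over the
nonempty ones. This evaluates the crossing sets. -/
theorem connExcess_join {B C : Finset V} (hd : Disjoint B C)
    (h : ∀ b ∈ B, ∀ c ∈ C, G.Adj b c) :
    G.connExcess (B ∪ C) = G.connExcess B + G.connExcess C +
      C.card * G.connCount B + B.card * G.connCount C +
      (2 ^ B.card - 1 - B.card) * (2 ^ C.card - 1 - C.card) +
      (2 ^ B.card - 1) * (2 ^ C.card - 1) - B.card * C.card := by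
  unfold connExcess
  rw [connCount_join hd h, two_mul_connWeight_join hd h, card_union_of_disjoint hd]
  push_cast
  ring

/-- The only negative term, -|B||C| in a join, is absorbed because p ≤ 2^p-1. -/
theorem InducedPathFree.connExcess_nonneg (hG : G.InducedPathFree) (A : Finset V) :
    0 ≤ G.connExcess A := by
  induction A using Finset.strongInduction with
  | H A ih =>
    rcases Nat.lt_or_ge A.card 2 with hA | hA
    · simp [connExcess, connCount, connWeight, connSets_eq_empty hA]
    · obtain ⟨B, C, hB, hC, hd, rfl, hadj⟩ := hG.exists_split A hA
      have hB' := ih B (ssubset_of_subset_of_ne subset_union_left fun e => by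
        have := card_union_of_disjoint hd
        rw [← e] at this
        have := hC.card_pos
        omega)
      have hC' := ih C (ssubset_of_subset_of_ne subset_union_right fun e => by
        have := card_union_of_disjoint hd
        rw [← e] at this
        have := hB.card_pos
        omega)
      have h1 := mul_nonneg (Nat.cast_nonneg (α := ℝ) C.card) (G.connCount_nonneg B)
      have h2 := mul_nonneg (Nat.cast_nonneg (α := ℝ) B.card) (G.connCount_nonneg C)
      rcases hadj with hadj | hadj
      · rw [connExcess_union hd hadj]
        positivity
      · rw [connExcess_join hd hadj]
        have h3 := natCast_le_two_pow_sub_one B.card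
        have h4 := natCast_le_two_pow_sub_one C.card
        have h5 := mul_le_mul h3 h4 (by positivity) ((Nat.cast_nonneg _).trans h3)
        nlinarith [mul_nonneg (sub_nonneg.mpr h3) (sub_nonneg.mpr h4)]

theorem InducedPathFree.sq_mul_connCount_lt (hG : G.InducedPathFree) {A : Finset V}
    (hA : 6 ≤ A.card) (hpos : 1 ≤ G.connCount A) :
    (A.card : ℝ) ^ 2 * G.connCount A < (2 ^ A.card + A.card) * G.connExcess A := by
  have hm := five_mul_sq_le hA
  have hk : 0 < (2 : ℝ) ^ A.card + A.card := by positivity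
  obtain ⟨B, C, hB, hC, hd, rfl, hadj⟩ := hG.exists_split A (by omega)
  have hEB := hG.connExcess_nonneg B
  have hEC := hG.connExcess_nonneg C
  have hp : (1 : ℝ) ≤ B.card := by exact_mod_cast hB.card_pos
  have hq : (1 : ℝ) ≤ C.card := by exact_mod_cast hC.card_pos
  have h1 := le_mul_of_one_le_left (G.connCount_nonneg B) hq
  have h2 := le_mul_of_one_le_left (G.connCount_nonneg C) hp
  have hNB := G.connCount_nonneg B
  have hNC := G.connCount_nonneg C
  rcases hadj with hadj | hadj
  · have hle : G.connCount (B ∪ C) ≤ G.connExcess (B ∪ C) := by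
      rw [connExcess_union hd hadj, connCount_union hd hadj]
      linarith
    have hlt : ((B ∪ C).card : ℝ) ^ 2 < 2 ^ (B ∪ C).card + (B ∪ C).card := by linarith
    calc _ < (2 ^ (B ∪ C).card + (B ∪ C).card) * G.connCount (B ∪ C) :=
          mul_lt_mul_of_pos_right hlt (by linarith)
      _ ≤ _ := mul_le_mul_of_nonneg_left hle hk.le
  -- The excess is at least N-|B||C|, and |B||C| < 2N/5. The remaining 3N/5 matches the 3/5 in
  -- `five_mul_sq_le`.
  · have h3 := natCast_le_two_pow_sub_one B.card
    have h4 := natCast_le_two_pow_sub_one C.card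
    have h5 := five_mul_mul_lt hB.card_pos hC.card_pos (card_union_of_disjoint hd ▸ hA)
    have hle : G.connCount (B ∪ C) - B.card * C.card ≤ G.connExcess (B ∪ C) := by
      rw [connExcess_join hd hadj, connCount_join hd hadj]
      nlinarith [mul_nonneg (sub_nonneg.mpr h3) (sub_nonneg.mpr h4)]
    have hN : (2 ^ B.card - 1) * (2 ^ C.card - 1) ≤ G.connCount (B ∪ C) := by
      rw [connCount_join hd hadj]
      linarith
    have hpq : 5 * ((B.card : ℝ) * C.card) < 2 * G.connCount (B ∪ C) := by linarith
    nlinarith [mul_le_mul_of_nonneg_left hle hk.le, mul_lt_mul_of_pos_left hpq hk,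
      mul_le_mul_of_nonneg_right hm (show 0 ≤ G.connCount (B ∪ C) by linarith)]

/-- The sum of `|A| + 1 - 2 |S|` over all non-empty connected subsets `S` of `A`. -/
noncomputable def connDeficit (G : SimpleGraph V) (A : Finset V) : ℝ :=
  A.card * (A.card - 1) + (A.card + 1) * G.connCount A - 2 * G.connWeight A

/-- The shift by 2 in `connExcess` comes from |B|+|C|+1 = (|B|+2)+(|C|-1), where |C|-1 ≥ 0 for
nonempty C. -/
theorem connDeficit_join {B C : Finset V} (hd : Disjoint B C)
    (h : ∀ b ∈ B, ∀ c ∈ C, G.Adj b c) :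
    G.connDeficit (B ∪ C) = G.connExcess B + G.connExcess C +
      (C.card - 1) * G.connCount B + (B.card - 1) * G.connCount C +
      ((2 ^ B.card - 1 - B.card) * (2 ^ C.card - 1 - C.card) - B.card * C.card +
        (B.card + C.card) * (B.card + C.card - 1)) := by
  unfold connExcess connDeficit
  rw [connCount_join hd h, two_mul_connWeight_join hd h, card_union_of_disjoint hd]
  push_cast
  ring

theorem InducedPathFree.connDeficit_pos (hG : G.InducedPathFree) {B C : Finset V}
    (hB : B.Nonempty) (hC : C.Nonempty) (hd : Disjoint B C)
    (h : ∀ b ∈ B, ∀ c ∈ C, G.Adj b c) : 0 < G.connDeficit (B ∪ C) := by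
  rw [connDeficit_join hd h]
  have hEB := hG.connExcess_nonneg B
  have hEC := hG.connExcess_nonneg C
  have hp : (1 : ℝ) ≤ B.card := by exact_mod_cast hB.card_pos
  have hq : (1 : ℝ) ≤ C.card := by exact_mod_cast hC.card_pos
  have h1 := mul_nonneg (sub_nonneg.mpr hq) (G.connCount_nonneg B)
  have h2 := mul_nonneg (sub_nonneg.mpr hp) (G.connCount_nonneg C)
  have h3 := mul_nonneg (sub_nonneg.mpr (natCast_le_two_pow_sub_one B.card))
    (sub_nonneg.mpr (natCast_le_two_pow_sub_one C.card))
  nlinarith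

theorem connDeficit_join_singleton {v : V} {C : Finset V} (hv : v ∉ C)
    (h : ∀ c ∈ C, G.Adj v c) :
    G.connDeficit ({v} ∪ C) = C.card ^ 2 + G.connExcess C := by
  have h0 : ({v} : Finset V).card < 2 := by simp
  rw [connDeficit_join (by simpa using hv) (by simpa using h)]
  simp only [connExcess, connCount, connWeight, connSets_eq_empty h0]
  simp
  ring

theorem connCount_join_singleton {v : V} {C : Finset V} (hv : v ∉ C)
    (h : ∀ c ∈ C, G.Adj v c) :
    G.connCount ({v} ∪ C) = G.connCount C + (2 ^ C.card - 1) := by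
  have h0 : ({v} : Finset V).card < 2 := by simp
  rw [connCount_join (by simpa using hv) (by simpa using h), connCount_eq_zero_of_card h0]
  norm_num

theorem InducedPathFree.lt_connDeficit_join (hG : G.InducedPathFree) {B C : Finset V}
    (hB : 2 ≤ B.card) (hBC : B.card ≤ C.card) (h7 : 7 ≤ B.card + C.card) (hd : Disjoint B C)
    (h : ∀ b ∈ B, ∀ c ∈ C, G.Adj b c) :
    ((B.card : ℝ) + C.card - 1) ^ 2 * (B.card + C.card + G.connCount (B ∪ C)) <
      (2 ^ (B.card + C.card - 1) + (B.card + C.card) - 1) * G.connDeficit (B ∪ C) := by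
  have hEB := hG.connExcess_nonneg B
  have hEC := hG.connExcess_nonneg C
  have hp : (2 : ℝ) ≤ B.card := by exact_mod_cast hB
  have hq : (2 : ℝ) ≤ C.card := by exact_mod_cast hB.trans hBC
  have h1 := le_mul_of_one_le_left (G.connCount_nonneg B) (show 1 ≤ (C.card : ℝ) - 1 by linarith)
  have h2 := le_mul_of_one_le_left (G.connCount_nonneg C) (show 1 ≤ (B.card : ℝ) - 1 by linarith)
  have key := join_contribution_lt hB hBC h7
  have hpow : (2 : ℝ) ^ (B.card + C.card - 1) = 2 ^ B.card * 2 ^ C.card / 2 := by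
    rw [← pow_add, eq_div_iff two_ne_zero, ← pow_succ, Nat.sub_add_cancel (by omega)]
  have hm := five_mul_sq_le (m := B.card + C.card - 1) (by omega)
  rw [hpow, Nat.cast_sub (by omega)] at hm
  push_cast at hm
  rw [connDeficit_join hd h, connCount_join hd h, hpow]
  set N := G.connCount B + G.connCount C with hN
  set k : ℝ := 2 ^ B.card * 2 ^ C.card / 2 + (B.card + C.card) - 1 with hk
  have hNpos : 0 ≤ N := add_nonneg (G.connCount_nonneg B) (G.connCount_nonneg C)
  -- Since (n-1)^2 ≤ k and both parts have at least two vertices, sets inside a part only help; the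
  -- rest is `join_contribution_lt`.
  have hkr : ((B.card : ℝ) + C.card - 1) ^ 2 ≤ k := by
    nlinarith [sq_nonneg ((B.card : ℝ) + C.card - 1)]
  have hk0 : 0 ≤ k := (sq_nonneg _).trans hkr
  have h3 := mul_le_mul_of_nonneg_right hkr hNpos
  have h4 : k * N ≤ k * (G.connExcess B + G.connExcess C +
      (C.card - 1) * G.connCount B + (B.card - 1) * G.connCount C) :=
    mul_le_mul_of_nonneg_left (by linarith) hk0
  nlinarith

end SimpleGraph

/-! ### Stars, the mean in terms of the deficit, and the extremal case. -/

namespace SimpleGraph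

variable {V : Type*}

/-- `v` is adjacent to all other vertices, and there are no further edges. -/
def IsStarAt (G : SimpleGraph V) (v : V) : Prop :=
  ∀ a b, G.Adj a b ↔ a ≠ b ∧ (a = v ∨ b = v)

theorem IsStarAt.nonempty_iso [Fintype V] {G : SimpleGraph V} {v : V} (h : G.IsStarAt v) :
    Nonempty (G ≃g completeBipartiteGraph (Fin 1) (Fin (Fintype.card V - 1))) := by
  classical
  have hcard : Fintype.card {a // ¬ a = v} = Fintype.card V - 1 := by
    rw [Fintype.card_subtype_compl, Fintype.card_subtype_eq]
  have hcard' : Fintype.card {a // a = v} = 1 := Fintype.card_subtype_eq v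
  let e : V ≃ Fin 1 ⊕ Fin (Fintype.card V - 1) := (Equiv.sumCompl (· = v)).symm.trans
    (Equiv.sumCongr (Fintype.equivFinOfCardEq hcard') (Fintype.equivFinOfCardEq hcard))
  have hl : ∀ a, (e a).isLeft = true ↔ a = v := by
    intro a
    by_cases ha : a = v
    · simp [e, ha]
    · simp [e, Equiv.sumCompl_symm_apply_of_neg, ha]
  refine ⟨⟨e, fun {a b} => ?_⟩⟩
  have ha := hl a
  have hb := hl b
  rw [completeBipartiteGraph_adj, ← Sum.not_isLeft, ← Sum.not_isLeft, h]
  simp only [ha, hb]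
  constructor
  · rintro (⟨rfl, hne⟩ | ⟨hne, rfl⟩)
    · exact ⟨fun e => hne e.symm, Or.inl rfl⟩
    · exact ⟨hne, Or.inr rfl⟩
  · rintro ⟨hne, rfl | rfl⟩
    · exact Or.inl ⟨rfl, fun e => hne e.symm⟩
    · exact Or.inr ⟨hne, rfl⟩

theorem exists_isStarAt_of_iso {G : SimpleGraph V} {m : ℕ}
    (e : G ≃g completeBipartiteGraph (Fin 1) (Fin m)) : ∃ v, G.IsStarAt v := by
  refine ⟨e.symm (Sum.inl 0), fun a b => ?_⟩
  have key : ∀ a, a = e.symm (Sum.inl 0) ↔ (e a).isLeft = true := by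
    intro a
    rw [← e.apply_eq_iff_eq, e.apply_symm_apply]
    rcases e a with x | x
    · simp [Subsingleton.elim x 0]
    · simp
  rw [← e.map_adj_iff, completeBipartiteGraph_adj, key, key, ← e.injective.ne_iff]
  rcases e a with x | x <;> rcases e b with y | y
  · simp [Subsingleton.elim x y]
  all_goals simp

theorem connected_completeBipartiteGraph_star (m : ℕ) :
    (completeBipartiteGraph (Fin 1) (Fin m)).Connected := by
  have key : ∀ x, (completeBipartiteGraph (Fin 1) (Fin m)).Reachable (Sum.inl 0) x := by
    rintro (x | x)
    · rw [Subsingleton.elim x 0]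
    · exact Adj.reachable (by simp)
  exact Connected.mk fun x y => (key x).symm.trans (key y)

/-- The ends of a three-edge path lie on opposite sides, hence are adjacent. -/
theorem isCograph_completeBipartiteGraph (α β : Type*) :
    (completeBipartiteGraph α β).IsCograph := by
  rintro ⟨f⟩
  have h01 : (completeBipartiteGraph α β).Adj (f 0) (f 1) :=
    f.map_adj_iff.mpr (by simp [pathGraph_adj])
  have h12 : (completeBipartiteGraph α β).Adj (f 1) (f 2) :=
    f.map_adj_iff.mpr (by simp [pathGraph_adj])
  have h23 : (completeBipartiteGraph α β).Adj (f 2) (f 3) :=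
    f.map_adj_iff.mpr (by simp [pathGraph_adj])
  have h03 : ¬ (completeBipartiteGraph α β).Adj (f 0) (f 3) := fun h => by
    simpa [pathGraph_adj] using f.map_adj_iff.mp h
  revert h01 h12 h23 h03
  rcases f 0 with _ | _ <;> rcases f 1 with _ | _ <;> rcases f 2 with _ | _ <;>
    rcases f 3 with _ | _ <;> simp

variable [Fintype V]

/-- Constant f gives Φ(1) and f(k) = k gives Φ'(1); singletons form the first term. -/
theorem sum_numConnectedInduced_mul (G : SimpleGraph V) (f : ℕ → ℝ) :
    ∑ k ∈ Finset.Icc 1 (Fintype.card V), (G.numConnectedInduced k : ℝ) * f k =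
      Fintype.card V * f 1 + ∑ S ∈ G.connSets univ, f S.card := by
  classical
  set T := univ.filter fun S : Finset V => (G.induce (S : Set V)).Connected with hT
  have hpos : ∀ S ∈ T, 1 ≤ S.card := by
    intro S hS
    obtain ⟨⟨x, hx⟩⟩ := (mem_filter.mp hS).2.nonempty
    exact Finset.card_pos.mpr ⟨x, hx⟩
  have h1 : ∑ k ∈ Finset.Icc 1 (Fintype.card V), (G.numConnectedInduced k : ℝ) * f k =
      ∑ S ∈ T, f S.card := by
    rw [← sum_fiberwise_of_maps_to (t := Finset.Icc 1 (Fintype.card V)) (g := Finset.card)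
      fun S hS => mem_Icc.mpr ⟨hpos S hS, card_le_univ S⟩]
    refine sum_congr rfl fun k _ => ?_
    rw [sum_congr rfl fun S hS => by rw [(mem_filter.mp hS).2], sum_const, nsmul_eq_mul, hT,
      filter_filter]
    simp only [numConnectedInduced, and_comm]
  have h2 : T.filter (fun S => ¬ 2 ≤ S.card) =
      univ.map ⟨fun v : V => ({v} : Finset V), Finset.singleton_injective⟩ := by
    ext S
    simp only [mem_filter, mem_map, mem_univ, true_and, Function.Embedding.coeFn_mk]
    constructor
    · rintro ⟨hS, h⟩
      have := hpos S hS
      obtain ⟨v, rfl⟩ := Finset.card_eq_one.mp (show S.card = 1 by omega)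
      exact ⟨v, rfl⟩
    · rintro ⟨v, rfl⟩
      refine ⟨mem_filter.mpr ⟨mem_univ _, ?_⟩, by simp⟩
      rw [Finset.coe_singleton]
      have : Nonempty ({v} : Set V) := ⟨⟨v, rfl⟩⟩
      exact Connected.mk fun x y => by rw [Subsingleton.elim x y]
  have h3 : T.filter (fun S => 2 ≤ S.card) = G.connSets univ := by
    ext S
    simp [hT, mem_connSets, and_comm]
  rw [h1, ← sum_filter_not_add_sum_filter T (fun S => 2 ≤ S.card), h2, h3, sum_map]
  simp

theorem globalMean_eq (G : SimpleGraph V) :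
    G.globalMean = (Fintype.card V + G.connWeight univ) / (Fintype.card V + G.connCount univ) := by
  have h1 := G.sum_numConnectedInduced_mul fun _ => 1
  have h2 := G.sum_numConnectedInduced_mul fun k => k
  simp only [mul_one, sum_const, nsmul_eq_mul, Nat.cast_one] at h1 h2
  rw [globalMean, connectedInducedPoly, Polynomial.derivative_sum, Polynomial.eval_finsetSum,
    Polynomial.eval_finsetSum]
  simp only [Polynomial.derivative_C_mul, Polynomial.derivative_X_pow, Polynomial.eval_mul,
    Polynomial.eval_C, Polynomial.eval_pow, Polynomial.eval_X, one_pow, mul_one]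
  rw [h1, h2, connWeight, connCount]

theorem globalMean_eq_sub [Nonempty V] (G : SimpleGraph V) :
    G.globalMean = ((Fintype.card V : ℝ) + 1) / 2 -
      G.connDeficit univ / (2 * (Fintype.card V + G.connCount univ)) := by
  have hn : (0 : ℝ) < Fintype.card V := by exact_mod_cast Fintype.card_pos
  have hN := G.connCount_nonneg univ
  rw [globalMean_eq, connDeficit, card_univ]
  field_simp
  ring

/-- A star attains the bound on the deficit. -/
theorem IsStarAt.connDeficit_eq {G : SimpleGraph V} {v : V} (h : G.IsStarAt v) :
    ((Fintype.card V : ℝ) - 1) ^ 2 * (Fintype.card V + G.connCount univ) =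
      (2 ^ (Fintype.card V - 1) + Fintype.card V - 1) * G.connDeficit univ := by
  classical
  have hv : v ∉ univ.erase v := by simp
  have hU : {v} ∪ univ.erase v = univ := by
    rw [← Finset.insert_eq, Finset.insert_erase (mem_univ v)]
  have hadj : ∀ c ∈ univ.erase v, G.Adj v c := fun c hc =>
    (h v c).mpr ⟨(ne_of_mem_erase hc).symm, Or.inl rfl⟩
  have hempty : G.connSets (univ.erase v) = ∅ := by
    refine Finset.eq_empty_of_forall_notMem fun S hS => ?_
    obtain ⟨hS, h2, hc⟩ := mem_connSets.mp hS
    obtain ⟨a, ha, b, hb, hab⟩ := Finset.one_lt_card.mp h2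
    -- No leaf is adjacent to another, so a connected S could not contain both a and b.
    rcases subset_or_subset_of_connected (B := {a}) (C := S.erase a)
      (by rw [← Finset.insert_eq, Finset.insert_erase ha]) (fun x hx y hy hxy => by
        rw [mem_singleton.mp hx] at hxy
        rcases ((h _ _).mp hxy).2 with e | e
        · exact ne_of_mem_erase (hS ha) e
        · exact ne_of_mem_erase (hS (mem_of_mem_erase hy)) e) hc with h3 | h3
    · exact hab (mem_singleton.mp (h3 hb)).symm
    · exact notMem_erase a S (h3 ha)
  have hcard : (univ.erase v).card = Fintype.card V - 1 := by
    rw [card_erase_of_mem (mem_univ v), card_univ]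
  have hn : 1 ≤ Fintype.card V := Fintype.card_pos_iff.mpr ⟨v⟩
  rw [← hU, connDeficit_join_singleton hv hadj, connCount_join_singleton hv hadj]
  simp only [connExcess, connCount, connWeight, hempty, hcard, Nat.cast_sub hn]
  simp
  ring

theorem Connected.exists_join [DecidableEq V] {G : SimpleGraph V} (hconn : G.Connected)
    (hG : G.InducedPathFree) (hn : 2 ≤ Fintype.card V) :
    ∃ B C : Finset V, B.Nonempty ∧ C.Nonempty ∧ B.card ≤ C.card ∧ Disjoint B C ∧
      B ∪ C = univ ∧ ∀ b ∈ B, ∀ c ∈ C, G.Adj b c := by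
  obtain ⟨B, C, hB, hC, hd, hU, hadj | hadj⟩ := hG.exists_split univ (by simpa using hn)
  · exfalso
    have hc : (G.induce ((univ : Finset V) : Set V)).Connected := by
      rw [Finset.coe_univ]
      exact (induceUnivIso G).connected_iff.mpr hconn
    obtain ⟨b, hb⟩ := hB
    obtain ⟨c, hc'⟩ := hC
    rcases subset_or_subset_of_connected hU.symm.subset hadj hc with h | h
    · exact Finset.disjoint_left.mp hd (h (mem_univ c)) hc'
    · exact Finset.disjoint_left.mp hd hb (h (mem_univ b))
  · rcases le_total B.card C.card with h | h
    · exact ⟨B, C, hB, hC, h, hd, hU, hadj⟩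
    · exact ⟨C, B, hC, hB, h, hd.symm, by rw [union_comm, hU], fun c hc b hb =>
        (hadj b hb c hc).symm⟩

theorem Connected.connDeficit_univ_pos {G : SimpleGraph V} (hconn : G.Connected)
    (hG : G.InducedPathFree) (hn : 2 ≤ Fintype.card V) : 0 < G.connDeficit univ := by
  classical
  obtain ⟨B, C, hB, hC, -, hd, hU, hadj⟩ := hconn.exists_join hG hn
  rw [← hU]
  exact hG.connDeficit_pos hB hC hd hadj

/-- Among connected cographs, only stars attain the bound on the deficit. -/
theorem Connected.lt_connDeficit_of_not_isStarAt {G : SimpleGraph V} (hconn : G.Connected)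
    (hG : G.InducedPathFree) (hn : 7 ≤ Fintype.card V) (hstar : ¬ ∃ v, G.IsStarAt v) :
    ((Fintype.card V : ℝ) - 1) ^ 2 * (Fintype.card V + G.connCount univ) <
      (2 ^ (Fintype.card V - 1) + Fintype.card V - 1) * G.connDeficit univ := by
  classical
  obtain ⟨B, C, hB, hC, hle, hd, hU, hadj⟩ := hconn.exists_join hG (by omega)
  have hcard : Fintype.card V = B.card + C.card := by
    rw [← card_union_of_disjoint hd, hU, card_univ]
  rw [hcard] at hn ⊢
  push_cast
  rcases Nat.lt_or_ge B.card 2 with hB2 | hB2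
  · obtain ⟨v, rfl⟩ := Finset.card_eq_one.mp (show B.card = 1 by have := hB.card_pos; omega)
    have hv : v ∉ C := by simpa using hd
    have hadj' : ∀ c ∈ C, G.Adj v c := by simpa using hadj
    have hmem : ∀ a, a ≠ v → a ∈ C := fun a ha => by
      have := mem_univ a
      rw [← hU] at this
      simpa [ha] using this
    -- An edge inside C is itself a connected pair, so a zero count would make G a star.
    have hpos : 1 ≤ G.connCount C := by
      refine (G.connCount_eq_zero_or_one_le C).resolve_left fun h0 => hstar ⟨v, fun a b => ?_⟩
      have hempty : G.connSets C = ∅ := by simpa [connCount] using h0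
      constructor
      · intro hab
        refine ⟨hab.ne, ?_⟩
        by_contra! hne
        have : ({a} ∪ {b} : Finset V) ∈ G.connSets C := by
          refine mem_connSets.mpr ⟨?_, ?_, connected_induce_union_of_forall_adj (by simp) (by simp)
            (by simpa using hab)⟩
          · exact union_subset (by simpa using hmem a hne.1) (by simpa using hmem b hne.2)
          · rw [card_union_of_disjoint (by simpa using hab.ne)]
            simp
        simp [hempty] at this
      · rintro ⟨hne, rfl | rfl⟩
        · exact hadj' b (hmem b hne.symm)
        · exact (hadj' a (hmem a hne)).symm
    rw [card_singleton] at hn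
    have key := hG.sq_mul_connCount_lt (show 6 ≤ C.card by omega) hpos
    rw [← hU, connDeficit_join_singleton hv hadj', connCount_join_singleton hv hadj',
      card_singleton, Nat.add_sub_cancel_left]
    push_cast
    nlinarith
  · have := hG.lt_connDeficit_join hB2 hle hn hd hadj
    rw [← hU]
    linarith

theorem IsStarAt.globalMean_eq {G : SimpleGraph V} {v : V} (h : G.IsStarAt v) :
    G.globalMean = ((Fintype.card V : ℝ) + 1) / 2 - ((Fintype.card V : ℝ) - 1) ^ 2 /
      (2 * ((2 : ℝ) ^ (Fintype.card V - 1) + (Fintype.card V : ℝ) - 1)) := by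
  have : Nonempty V := ⟨v⟩
  have hn : (1 : ℝ) ≤ Fintype.card V := by exact_mod_cast Fintype.card_pos
  have hN := G.connCount_nonneg univ
  have hk : 0 < (2 : ℝ) ^ (Fintype.card V - 1) := by positivity
  rw [globalMean_eq_sub, sub_right_inj, div_eq_div_iff (by positivity) (by linarith)]
  linarith [h.connDeficit_eq]

theorem Connected.globalMean_lt_of_not_isStarAt {G : SimpleGraph V} (hconn : G.Connected)
    (hG : G.InducedPathFree) (hn : 7 ≤ Fintype.card V) (hstar : ¬ ∃ v, G.IsStarAt v) :
    G.globalMean < ((Fintype.card V : ℝ) + 1) / 2 - ((Fintype.card V : ℝ) - 1) ^ 2 /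
      (2 * ((2 : ℝ) ^ (Fintype.card V - 1) + (Fintype.card V : ℝ) - 1)) := by
  have := hconn.nonempty
  have hn : (1 : ℝ) ≤ Fintype.card V := by exact_mod_cast Fintype.card_pos
  have hN := G.connCount_nonneg univ
  have hk : 0 < (2 : ℝ) ^ (Fintype.card V - 1) := by positivity
  rw [globalMean_eq_sub, sub_lt_sub_iff_left, div_lt_div_iff₀ (by linarith) (by positivity)]
  linarith [hconn.lt_connDeficit_of_not_isStarAt hG ‹_› hstar]

theorem globalMean_of_card_eq_one {G : SimpleGraph V} (h : Fintype.card V = 1) :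
    G.globalMean = 1 := by
  simp [SimpleGraph.globalMean_eq, connWeight, connCount, h,
    connSets_eq_empty (G := G) (A := univ) (by simp [h])]

theorem Connected.globalMean_lt {G : SimpleGraph V} (hconn : G.Connected)
    (hG : G.InducedPathFree) (hn : 2 ≤ Fintype.card V) :
    G.globalMean < ((Fintype.card V : ℝ) + 1) / 2 := by
  have := hconn.nonempty
  have hcard : (0 : ℝ) < Fintype.card V := by exact_mod_cast Fintype.card_pos
  have hN := G.connCount_nonneg univ
  have hD := hconn.connDeficit_univ_pos hG hn
  rw [globalMean_eq_sub]
  exact sub_lt_self _ (by positivity)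

end SimpleGraph

open SimpleGraph in
theorem mainTheorem1 {V : Type*} [Fintype V] (G : SimpleGraph V) (n : ℕ)
    (hn : Fintype.card V = n) (hconn : G.Connected) (hcog : G.IsCograph) :
    (7 ≤ n →
      (G.globalMean ≤
          ((n : ℝ) + 1) / 2 - ((n : ℝ) - 1) ^ 2 / (2 * ((2 : ℝ) ^ (n - 1) + (n : ℝ) - 1)) ∧
        (G.globalMean =
            ((n : ℝ) + 1) / 2 - ((n : ℝ) - 1) ^ 2 / (2 * ((2 : ℝ) ^ (n - 1) + (n : ℝ) - 1)) ↔
          Nonempty (G ≃g completeBipartiteGraph (Fin 1) (Fin (n - 1))))) ∧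
      ((completeBipartiteGraph (Fin 1) (Fin (n - 1))).Connected ∧
        (completeBipartiteGraph (Fin 1) (Fin (n - 1))).IsCograph ∧
        G.globalMean ≤ (completeBipartiteGraph (Fin 1) (Fin (n - 1))).globalMean ∧
        (G.globalMean = (completeBipartiteGraph (Fin 1) (Fin (n - 1))).globalMean ↔
          Nonempty (G ≃g completeBipartiteGraph (Fin 1) (Fin (n - 1)))))) ∧
    (G.globalMean ≤ ((n : ℝ) + 1) / 2 ∧
      (G.globalMean = ((n : ℝ) + 1) / 2 ↔ n = 1)) := by
  subst hn
  have hG := hcog.inducedPathFree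
  constructor
  · intro h7
    have hstar : (completeBipartiteGraph (Fin 1) (Fin (Fintype.card V - 1))).globalMean =
        ((Fintype.card V : ℝ) + 1) / 2 - ((Fintype.card V : ℝ) - 1) ^ 2 /
          (2 * ((2 : ℝ) ^ (Fintype.card V - 1) + (Fintype.card V : ℝ) - 1)) := by
      obtain ⟨v, hv⟩ := exists_isStarAt_of_iso
        (Iso.refl (G := completeBipartiteGraph (Fin 1) (Fin (Fintype.card V - 1))))
      have hc : Fintype.card (Fin 1 ⊕ Fin (Fintype.card V - 1)) = Fintype.card V := by
        simp only [Fintype.card_sum, Fintype.card_fin]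
        omega
      rw [hv.globalMean_eq, hc]
    have key : G.globalMean ≤ ((Fintype.card V : ℝ) + 1) / 2 - ((Fintype.card V : ℝ) - 1) ^ 2 /
          (2 * ((2 : ℝ) ^ (Fintype.card V - 1) + (Fintype.card V : ℝ) - 1)) ∧
        (G.globalMean = ((Fintype.card V : ℝ) + 1) / 2 - ((Fintype.card V : ℝ) - 1) ^ 2 /
          (2 * ((2 : ℝ) ^ (Fintype.card V - 1) + (Fintype.card V : ℝ) - 1)) ↔
          Nonempty (G ≃g completeBipartiteGraph (Fin 1) (Fin (Fintype.card V - 1)))) := by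
      by_cases h : ∃ v, G.IsStarAt v
      · obtain ⟨v, hv⟩ := h
        exact ⟨hv.globalMean_eq.le, fun _ => hv.nonempty_iso, fun _ => hv.globalMean_eq⟩
      · have hlt := hconn.globalMean_lt_of_not_isStarAt hG h7 h
        exact ⟨hlt.le, fun e => absurd e hlt.ne, fun ⟨e⟩ => absurd (exists_isStarAt_of_iso e) h⟩
    rw [hstar]
    exact ⟨key, connected_completeBipartiteGraph_star _, isCograph_completeBipartiteGraph _ _, key⟩
  · have hpos : 1 ≤ Fintype.card V := Fintype.card_pos_iff.mpr hconn.nonempty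
    rcases hpos.eq_or_lt with h1 | h2
    · rw [globalMean_of_card_eq_one h1.symm, ← h1]
      norm_num
    · have hlt := hconn.globalMean_lt hG h2
      exact ⟨hlt.le, fun e => absurd e hlt.ne, fun e => absurd e (by omega)⟩
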